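/- Let $F$ be a field with algebraic closure $\overline F$, let $A$ be an $n\times n$ matrix over $F$, let $m\ge 0$ be an integer, and let $q\in F[x]$. For $\lambda\in\overline F$ let $m_\lambda(q)$ denote the multiplicity of $\lambda$ as a zero of $q$ (it is $0$ if $q(\lambda)\ne 0$, and $m_\lambda(0)=\infty$), let $\mathrm{alg}_\lambda(A)=m_\lambda(p_A)$, where $p_A$ is the characteristic polynomial of $A$, and let $k_{\lambda,1}\ge k_{\lambda,2}\ge\cdots$ be the sizes of all Jordan blocks with eigenvalue $\lambda$ in the Jordan form of $A$ over $\overline F$, continued by zeros. Let $p_1\mid p_2\mid\cdots\mid p_s$ be the invariant factors of $A$, that is, monic polynomials in $F[x]$ such that $A$ is similar over $F$ to the block diagonal matrix whose blocks are the companion matrices of $p_1,\dots,p_s$. Then the condition \[ m_\lambda(q)\ \ge\ \mathrm{alg}_\lambda(A)-\sum_{j=1}^m k_{\lambda,j}\qquad\text{for every eigenvalue }\lambda\in\overline F\text{ of }A \] is equivalent to the divisibility $p_1p_2\cdots p_{s-m}\mid q$ in $F[x]$, where the product is $1$ if $m\ge s$. -/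

import Mathlib

open Polynomial

noncomputable section

/-- `m_λ(q)`: the multiplicity of `lam` (in an extension `K` of `F`) as a zero of `q`. It is `0` if
`lam` is not a zero of `q`, and `∞` for the zero polynomial. -/
def zeroMult {F K : Type*} [Field F] [Field K] [Algebra F K] (lam : K) (q : F[X]) : ℕ∞ :=
  emultiplicity (X - C lam) (q.map (algebraMap F K))

/-- `alg_λ(A)`: the algebraic multiplicity, `m_λ` of the characteristic polynomial. -/
def algMult {F K : Type*} [Field F] [Field K] [Algebra F K] {n : ℕ}
    (lam : K) (A : Matrix (Fin n) (Fin n) F) : ℕ∞ :=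
  zeroMult lam A.charpoly

/-- Similarity of square matrices over `R`; the two index types may differ, so the mutually inverse
matrices `P` and `Q` are formally rectangular. -/
def MatSimilar {R ι κ : Type*} [CommRing R] [Fintype ι] [DecidableEq ι] [Fintype κ]
    [DecidableEq κ] (A : Matrix ι ι R) (B : Matrix κ κ R) : Prop :=
  ∃ (P : Matrix ι κ R) (Q : Matrix κ ι R), P * Q = 1 ∧ Q * P = 1 ∧ A = P * B * Q

/-- The companion matrix of `x ^ d + a_{d-1} x ^ (d-1) + ⋯ + a_0`: ones on the subdiagonal, and
last column `-a_0, …, -a_{d-1}`. -/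
def companionMat {F : Type*} [Field F] (p : F[X]) :
    Matrix (Fin p.natDegree) (Fin p.natDegree) F :=
  Matrix.of fun i j =>
    if (j : ℕ) + 1 = p.natDegree then -p.coeff i
    else if (i : ℕ) = (j : ℕ) + 1 then 1 else 0

/-- `p 0 ∣ p 1 ∣ ⋯ ∣ p (s - 1)` are the invariant factors of `A`: `A` is similar over `F` to the
block diagonal matrix of their companion matrices. Factors equal to `1` (with empty
companion matrix) are permitted, to cover both usual conventions. -/
def IsRationalCanonicalForm {F : Type*} [Field F] {n s : ℕ} (A : Matrix (Fin n) (Fin n) F)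
    (p : Fin s → F[X]) : Prop :=
  (∀ i, (p i).Monic) ∧ (∀ i j, i ≤ j → p i ∣ p j) ∧
    MatSimilar A (Matrix.blockDiagonal' fun i => companionMat (p i))

/-- The `d × d` Jordan block with `lam` on the diagonal and ones on the superdiagonal. -/
def jordanBlock {K : Type*} [Field K] (lam : K) (d : ℕ) : Matrix (Fin d) (Fin d) K :=
  Matrix.of fun i j =>
    if i = j then lam else if (j : ℕ) = (i : ℕ) + 1 then 1 else 0

/-- The Jordan form of `A` consists of the (nonempty) Jordan blocks with eigenvalues `ev i` and
sizes `d i`. -/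
def IsJordanForm {K : Type*} [Field K] {n t : ℕ} (A : Matrix (Fin n) (Fin n) K)
    (ev : Fin t → K) (d : Fin t → ℕ) : Prop :=
  (∀ i, 0 < d i) ∧ MatSimilar A (Matrix.blockDiagonal' fun i => jordanBlock (ev i) (d i))

open Classical in
/-- `k_{λ,j+1}`: entry number `j` (counted from `0`) in the nonincreasing list of the sizes of all
Jordan blocks with eigenvalue `lam`, continued by zeros. -/
def jordanSize {K : Type*} {t : ℕ} (ev : Fin t → K) (d : Fin t → ℕ) (lam : K)
    (j : ℕ) : ℕ :=
  (((Finset.univ.filter fun i => ev i = lam).val.map d).sort (· ≥ ·)).getD j 0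

end

/-! Fix `λ` in `K` and let `e i` be the multiplicity of `λ` in `p i`. Companion matrices and Jordan
blocks both have a cyclic vector, so `finrank_ker_sub_pow_of_cyclic` computes the dimension of the
kernel of `(A - λ)^k` from either normal form: it is `∑ min k (e i)`, and also `∑ min k d` over the
Jordan blocks at `λ` of size `d`. These truncated sums determine the positive entries
(`filter_pos_eq_of_sum_min`), so the nonzero `e i` are exactly the block sizes at `λ`. The
divisibility chain makes `e` monotone, hence the `m` largest blocks belong to the last `m` invariant
factors. As `alg_λ(A) = ∑ e i`, the right side of the condition is the multiplicity of `λ` in `p_1 ⋯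
p_{s-m}`. Over an algebraically closed field, comparing multiplicities at all `λ` is divisibility.
-/

/-! ### Cyclic operators -/

/-- A linear map out of `K[X]` whose kernel is generated by `h ≠ 0` has rank `natDegree h`. -/
theorem finrank_range_of_ker_eq_multiples {K W : Type*} [Field K] [AddCommGroup W] [Module K W]
    (L : K[X] →ₗ[K] W) (h : K[X]) (h0 : h ≠ 0) (hL : ∀ f, L f = 0 ↔ h ∣ f) :
    Module.finrank K (LinearMap.range L) = h.natDegree := by
  set L' : degreeLT K h.natDegree →ₗ[K] W := L ∘ₗ (degreeLT K h.natDegree).subtype with hL'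
  have hinj : Function.Injective L' := by
    rw [← LinearMap.ker_eq_bot, LinearMap.ker_eq_bot']
    rintro ⟨f, hf⟩ hf0
    have hdvd : h ∣ f := (hL f).1 hf0
    have : f = 0 := by
      rw [mem_degreeLT, ← degree_eq_natDegree h0] at hf
      exact eq_zero_of_dvd_of_degree_lt hdvd hf
    exact Subtype.ext this
  have hrange : LinearMap.range L' = LinearMap.range L := by
    apply le_antisymm
    · rintro _ ⟨f, rfl⟩
      exact ⟨f, rfl⟩
    · rintro _ ⟨f, rfl⟩
      refine ⟨⟨f % h, ?_⟩, ?_⟩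
      · rw [mem_degreeLT, ← degree_eq_natDegree h0]
        exact EuclideanDomain.mod_lt f h0
      · change L (f % h) = L f
        rw [← sub_eq_zero, ← map_sub, hL]
        exact ⟨-(f / h), by linear_combination EuclideanDomain.mod_add_div f h⟩
  rw [← hrange, LinearMap.finrank_range_of_inj hinj,
    (degreeLTEquiv K h.natDegree).finrank_eq, Module.finrank_fin_fun]

/-- `v` is a cyclic vector of `T`, and `P` is its annihilator. -/
theorem aeval_apply_eq_zero_iff_of_cyclic {K V : Type*} [Field K] [AddCommGroup V] [Module K V]
    (T : Module.End K V) (v : V) (P : K[X]) (hP0 : P ≠ 0)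
    (hP : aeval T P v = 0) (hdeg : Module.finrank K V = P.natDegree)
    (hv : ∀ w, ∃ f : K[X], aeval T f v = w) (f : K[X]) :
    aeval T f v = 0 ↔ P ∣ f := by
  have hmul : ∀ g f : K[X], aeval T f v = 0 → aeval T (g * f) v = 0 := fun g f hf => by
    rw [map_mul, Module.End.mul_apply, hf, map_zero]
  let I : Ideal K[X] :=
    { carrier := {f | aeval T f v = 0}
      add_mem' := fun {a b} ha hb => by
        change aeval T a v = 0 at ha
        change aeval T b v = 0 at hb
        change aeval T (a + b) v = 0
        rw [map_add, LinearMap.add_apply, ha, hb, add_zero]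
      zero_mem' := by simp
      smul_mem' := fun g f hf => hmul g f hf }
  obtain ⟨h, hI⟩ := IsPrincipalIdealRing.principal I
  have hmem : ∀ f, aeval T f v = 0 ↔ h ∣ f := fun f => by
    rw [← Ideal.mem_span_singleton, ← Ideal.submodule_span_eq, ← hI]; rfl
  have hhP : h ∣ P := (hmem P).1 hP
  have h0 : h ≠ 0 := ne_zero_of_dvd_ne_zero hP0 hhP
  let L : K[X] →ₗ[K] V := (LinearMap.applyₗ v) ∘ₗ (aeval T).toLinearMap
  have hr := finrank_range_of_ker_eq_multiples L h h0 hmem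
  have htop : LinearMap.range L = ⊤ := LinearMap.range_eq_top.2 hv
  -- The generator `h` of the annihilator has degree `dim V = deg P`, so the cofactor of `h` in `P`
  -- is constant.
  rw [htop, finrank_top, hdeg] at hr
  obtain ⟨c, rfl⟩ := hhP
  have hc0 : c ≠ 0 := right_ne_zero_of_mul hP0
  rw [natDegree_mul h0 hc0] at hr
  have hc : IsUnit c := by
    rw [isUnit_iff_degree_eq_zero, degree_eq_natDegree hc0]
    simp; omega
  rw [hmem, hc.mul_right_dvd]

/-- Here `V` is `K[X]/(P)`. The image of `(T - a)^k` is generated by `(T - a)^k v`, whose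
annihilator is `P / (X - a)^(min k e)`; rank-nullity then gives the kernel. -/
theorem finrank_ker_sub_pow_of_cyclic {K V : Type*} [Field K] [AddCommGroup V] [Module K V]
    [FiniteDimensional K V] (T : Module.End K V) (v : V) (P : K[X]) (hP0 : P ≠ 0)
    (hP : aeval T P v = 0) (hdeg : Module.finrank K V = P.natDegree)
    (hv : ∀ w, ∃ f : K[X], aeval T f v = w) (a : K) (k : ℕ) :
    Module.finrank K (LinearMap.ker ((T - algebraMap K _ a) ^ k)) = min k (rootMultiplicity a P) := by
  have hann := aeval_apply_eq_zero_iff_of_cyclic T v P hP0 hP hdeg hv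
  obtain ⟨R, hR, hRnd⟩ := exists_eq_pow_rootMultiplicity_mul_and_not_dvd P hP0 a
  set e := rootMultiplicity a P with he
  have hR0 : R ≠ 0 := by rintro rfl; simp at hRnd
  have hX : (X - C a : K[X]) ≠ 0 := X_sub_C_ne_zero a
  have hT : (T - algebraMap K _ a) ^ k = aeval T ((X - C a) ^ k) := by simp
  let L : K[X] →ₗ[K] V := ((LinearMap.applyₗ v) ∘ₗ (aeval T).toLinearMap) ∘ₗ
    LinearMap.mulLeft K ((X - C a) ^ k)
  have hLa : ∀ f, L f = aeval T ((X - C a) ^ k * f) v := fun f => rfl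
  have hrange : LinearMap.range L = LinearMap.range ((T - algebraMap K _ a) ^ k) := by
    rw [hT]
    ext w
    constructor
    · rintro ⟨f, rfl⟩
      exact ⟨aeval T f v, by rw [hLa, map_mul, Module.End.mul_apply]⟩
    · rintro ⟨u, rfl⟩
      obtain ⟨f, rfl⟩ := hv u
      exact ⟨f, by rw [hLa, map_mul, Module.End.mul_apply]⟩
  have hdvd : ∀ f, L f = 0 ↔ (X - C a) ^ (e - min k e) * R ∣ f := by
    intro f
    rw [hLa, hann]
    -- One of the exponents `k - min k e` and `e - min k e` is zero, so nothing common survives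
    -- cancelling `(X - a)^(min k e)`.
    have hco : IsCoprime ((X - C a) ^ (k - min k e)) ((X - C a) ^ (e - min k e) * R) := by
      rcases le_total k e with h | h
      · rw [min_eq_left h, Nat.sub_self, pow_zero]; exact isCoprime_one_left
      · simp only [min_eq_right h, Nat.sub_self, pow_zero, one_mul]
        exact ((irreducible_X_sub_C a).coprime_iff_not_dvd.2 hRnd).pow_left
    have h1 : P = (X - C a) ^ min k e * ((X - C a) ^ (e - min k e) * R) := by
      rw [← mul_assoc, ← pow_add, Nat.add_sub_cancel' (min_le_right k e)]; exact hR
    have h2 : (X - C a) ^ k * f = (X - C a) ^ min k e * ((X - C a) ^ (k - min k e) * f) := by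
      rw [← mul_assoc, ← pow_add, Nat.add_sub_cancel' (min_le_left k e)]
    rw [h2]
    conv_lhs => rw [h1]
    rw [mul_dvd_mul_iff_left (pow_ne_zero _ hX)]
    exact ⟨fun h => hco.symm.dvd_of_dvd_mul_left h, fun h => h.mul_left _⟩
  have hr := finrank_range_of_ker_eq_multiples L _
    (mul_ne_zero (pow_ne_zero _ hX) hR0) hdvd
  rw [hrange, natDegree_mul (pow_ne_zero _ hX) hR0, natDegree_pow, natDegree_X_sub_C] at hr
  have hsum := LinearMap.finrank_range_add_finrank_ker ((T - algebraMap K _ a) ^ k)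
  have hPdeg : P.natDegree = e + R.natDegree := by
    conv_lhs => rw [hR]
    rw [natDegree_mul (pow_ne_zero _ hX) hR0, natDegree_pow, natDegree_X_sub_C, mul_one]
  have := min_le_right k e
  omega

/-! ### Companion matrices and Jordan blocks as cyclic operators -/

theorem eq_sum_smul_indicator {K : Type*} [Field K] {N : ℕ} (w : Fin N → K) :
    w = ∑ i : Fin N, w i • fun j : Fin N => if j = i then (1 : K) else 0 := by
  ext j
  simp [Finset.sum_apply]

/-- The first basis vector is cyclic: its iterates run through the basis, and the last column
encodes `P(T) v = 0`. The size `N` is kept apart from `P` so that the lemma applies to a companion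
matrix over `F` mapped into `K`, whose index type still mentions the original polynomial. -/
theorem finrank_ker_companion {K : Type*} [Field K] {N : ℕ} (P : K[X]) (hP : P.Monic)
    (hN : P.natDegree = N) (M : Matrix (Fin N) (Fin N) K)
    (hM : ∀ i j, M i j = if (j : ℕ) + 1 = N then -P.coeff i
      else if (i : ℕ) = (j : ℕ) + 1 then 1 else 0) (a : K) (k : ℕ) :
    Module.finrank K (LinearMap.ker ((Matrix.toLin' M - algebraMap K _ a) ^ k)) =
      min k (rootMultiplicity a P) := by
  set T : Module.End K (Fin N → K) := Matrix.toLin' M with hT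
  let v : Fin N → K := fun j => if (j : ℕ) = 0 then 1 else 0
  have hpow : ∀ i : ℕ, i < N → (T ^ i) v = fun j : Fin N => if (j : ℕ) = i then 1 else 0 := by
    intro i
    induction i with
    | zero => intro _; rfl
    | succ i ih =>
      intro hi
      rw [pow_succ', Module.End.mul_apply, ih (by omega)]
      ext j
      rw [hT, Matrix.toLin'_apply, Matrix.mulVec, dotProduct,
        Finset.sum_eq_single ⟨i, by omega⟩]
      · simp [hM, show i + 1 ≠ N by omega]
      · intro b _ hb
        have : (b : ℕ) ≠ i := fun h => hb (Fin.ext h)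
        simp [this]
      · simp
  have hlast : (T ^ N) v = fun j : Fin N => -P.coeff j := by
    rcases Nat.eq_zero_or_pos N with h0 | hpos
    · subst h0; exact Subsingleton.elim _ _
    obtain ⟨l, rfl⟩ : ∃ l, N = l + 1 := ⟨N - 1, by omega⟩
    rw [pow_succ', Module.End.mul_apply, hpow l (by omega)]
    ext j
    rw [hT, Matrix.toLin'_apply, Matrix.mulVec, dotProduct,
      Finset.sum_eq_single ⟨l, by omega⟩]
    · simp [hM]
    · intro b _ hb
      have : (b : ℕ) ≠ l := fun h => hb (Fin.ext h)
      simp [this]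
    · simp
  have hgen : ∀ w : Fin N → K, w = ∑ i : Fin N, w i • (T ^ (i : ℕ)) v := by
    intro w
    conv_lhs => rw [eq_sum_smul_indicator w]
    refine Finset.sum_congr rfl fun i _ => ?_
    rw [hpow i i.2]
    simp only [Fin.ext_iff]
  refine finrank_ker_sub_pow_of_cyclic T v P hP.ne_zero ?_ (by simp [hN]) ?_ a k
  · rw [aeval_eq_sum_range, Finset.sum_range_succ, hP.coeff_natDegree, hN, one_smul,
      LinearMap.add_apply, hlast, Finset.sum_range, LinearMap.sum_apply]
    have := hgen fun j : Fin N => P.coeff j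
    simp only [LinearMap.smul_apply]
    rw [← this]
    ext j
    simp
  · intro w
    refine ⟨∑ i : Fin N, C (w i) * X ^ (i : ℕ), ?_⟩
    conv_rhs => rw [hgen w]
    simp [map_sum, LinearMap.sum_apply, Module.algebraMap_end_apply]

/-- The last basis vector is cyclic, since `T - b` shifts it one place up at each step. -/
theorem finrank_ker_jordanBlock {K : Type*} [Field K] (b : K) (d : ℕ) (a : K) (k : ℕ) :
    Module.finrank K (LinearMap.ker ((Matrix.toLin' (jordanBlock b d) - algebraMap K _ a) ^ k)) =
      min k (rootMultiplicity a ((X - C b) ^ d)) := by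
  set T : Module.End K (Fin d → K) := Matrix.toLin' (jordanBlock b d) with hT
  let v : Fin d → K := fun j => if (j : ℕ) + 1 = d then 1 else 0
  -- For `i ≥ d` no index meets the condition, so the same formula contains the nilpotency of `T -
  -- b`.
  have hpow : ∀ i : ℕ, ((T - algebraMap K _ b) ^ i) v =
      fun j : Fin d => if (j : ℕ) + i + 1 = d then 1 else 0 := by
    intro i
    induction i with
    | zero => rfl
    | succ i ih =>
      rw [pow_succ', Module.End.mul_apply, ih]
      ext j
      rw [LinearMap.sub_apply, Module.algebraMap_end_apply, hT, Matrix.toLin'_apply]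
      have hsplit : ∀ l : Fin d, jordanBlock b d j l =
          (if j = l then b else 0) + (if (l : ℕ) = (j : ℕ) + 1 then 1 else 0) := by
        intro l
        by_cases h : j = l
        · subst h; simp [jordanBlock]
        · simp [jordanBlock, h]
      simp only [Pi.sub_apply, Matrix.mulVec, dotProduct, hsplit, add_mul, Finset.sum_add_distrib,
        Pi.smul_apply, smul_eq_mul, ite_mul, zero_mul, Finset.sum_ite_eq, Finset.mem_univ, if_true,
        add_sub_cancel_left, one_mul]
      by_cases hj : (j : ℕ) + 1 < d
      · rw [Finset.sum_eq_single ⟨j + 1, hj⟩]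
        · simp [show (j : ℕ) + 1 + i + 1 = j + (i + 1) + 1 by omega]
        · intro c _ hc
          rw [if_neg fun h => hc (Fin.ext h)]
        · simp
      · rw [Finset.sum_eq_zero, if_neg (by omega)]
        intro c _
        rw [if_neg (by have := c.2; omega)]
  refine finrank_ker_sub_pow_of_cyclic T v _ (pow_ne_zero _ (X_sub_C_ne_zero b)) ?_ (by simp) ?_ a k
  · have : aeval T ((X - C b) ^ d) = (T - algebraMap K _ b) ^ d := by simp
    rw [this, hpow]
    ext j
    exact if_neg (by omega)
  · intro w
    -- `(T - b)^i` sends `v` to the basis vector at `d - 1 - i`, hence the reversal.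
    refine ⟨∑ i : Fin d, C (w i.rev) * (X - C b) ^ (i : ℕ), ?_⟩
    have h1 : ∀ i : Fin d, aeval T (C (w i.rev) * (X - C b) ^ (i : ℕ)) v =
        w i.rev • fun j : Fin d => if j = i.rev then (1 : K) else 0 := by
      intro i
      rw [map_mul, Module.End.mul_apply, map_pow, map_sub, aeval_X, aeval_C, aeval_C, hpow,
        Module.algebraMap_end_apply]
      congr 1
      ext j
      congr 1
      rw [Fin.ext_iff, Fin.val_rev]
      have := i.2
      exact propext ⟨fun h => by omega, fun h => by omega⟩
    rw [map_sum, LinearMap.sum_apply, Finset.sum_congr rfl fun i _ => h1 i]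
    conv_rhs => rw [eq_sum_smul_indicator w]
    exact Equiv.sum_comp Fin.revPerm fun i => w i • fun j : Fin d => if j = i then (1 : K) else 0

/-! ### Kernel dimensions under block sums and similarity -/

theorem finrank_ker_blockDiagonal' {K o : Type*} [Field K] [Fintype o] [DecidableEq o]
    {m : o → Type*} [∀ i, Fintype (m i)] [∀ i, DecidableEq (m i)]
    (M : ∀ i, Matrix (m i) (m i) K) :
    Module.finrank K (LinearMap.ker (Matrix.toLin' (Matrix.blockDiagonal' M))) =
      ∑ i, Module.finrank K (LinearMap.ker (Matrix.toLin' (M i))) := by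
  have happ : ∀ (w : (Σ i, m i) → K) (i : o) (x : m i),
      (Matrix.blockDiagonal' M).mulVec w ⟨i, x⟩ = (M i).mulVec (fun y => w ⟨i, y⟩) x := by
    intro w i x
    rw [Matrix.mulVec, dotProduct, Fintype.sum_sigma, Finset.sum_eq_single i]
    · simp [Matrix.mulVec, dotProduct]
    · intro j _ hj
      exact Finset.sum_eq_zero fun y _ => by
        rw [Matrix.blockDiagonal'_apply_ne _ _ _ hj.symm, zero_mul]
    · simp
  let E : LinearMap.ker (Matrix.toLin' (Matrix.blockDiagonal' M)) ≃ₗ[K]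
      ((i : o) → LinearMap.ker (Matrix.toLin' (M i))) :=
    { toFun := fun w i => ⟨fun y => w.1 ⟨i, y⟩, by
        have := w.2
        rw [LinearMap.mem_ker, Matrix.toLin'_apply] at this ⊢
        ext x
        rw [← happ, this]; rfl⟩
      invFun := fun u => ⟨fun z => (u z.1).1 z.2, by
        rw [LinearMap.mem_ker, Matrix.toLin'_apply]
        ext ⟨i, x⟩
        rw [happ]
        have := (u i).2
        rw [LinearMap.mem_ker, Matrix.toLin'_apply] at this
        exact congrFun this x⟩
      map_add' := fun _ _ => rfl
      map_smul' := fun _ _ => rfl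
      left_inv := fun _ => rfl
      right_inv := fun _ => rfl }
  rw [E.finrank_eq, Module.finrank_pi_fintype]

theorem toLin'_sub_algebraMap_pow {K ι : Type*} [Field K] [Fintype ι] [DecidableEq ι]
    (M : Matrix ι ι K) (a : K) (k : ℕ) :
    (Matrix.toLin' M - algebraMap K (Module.End K (ι → K)) a) ^ k =
      Matrix.toLin' ((M - Matrix.scalar ι a) ^ k) := by
  have h := map_pow (Matrix.toLinAlgEquiv' (R := K) (n := ι)) (M - Matrix.scalar ι a) k
  rw [map_sub] at h
  have h2 : Matrix.toLinAlgEquiv' (R := K) (n := ι) (Matrix.scalar ι a) = algebraMap K _ a :=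
    (Matrix.toLinAlgEquiv' (R := K) (n := ι)).commutes a
  rw [h2] at h
  exact h.symm

theorem finrank_ker_eq_of_matSimilar {K ι κ : Type*} [Field K] [Fintype ι] [DecidableEq ι]
    [Fintype κ] [DecidableEq κ] {A : Matrix ι ι K} {B : Matrix κ κ K} (h : MatSimilar A B)
    (a : K) (k : ℕ) :
    Module.finrank K (LinearMap.ker ((Matrix.toLin' A - algebraMap K _ a) ^ k)) =
      Module.finrank K (LinearMap.ker ((Matrix.toLin' B - algebraMap K _ a) ^ k)) := by
  obtain ⟨P, Q, hPQ, hQP, rfl⟩ := h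
  let E : (κ → K) ≃ₗ[K] (ι → K) := Matrix.toLin'OfInv hQP hPQ
  have hE : E.conj (Matrix.toLin' B) = Matrix.toLin' (P * B * Q) := by
    ext; simp [E, LinearEquiv.conj_apply, Matrix.toLin'OfInv]
  have hE2 : E.conj ((Matrix.toLin' B - algebraMap K _ a) ^ k) =
      (Matrix.toLin' (P * B * Q) - algebraMap K _ a) ^ k := by
    rw [← hE]
    have h1 := map_pow (LinearEquiv.conjAlgEquiv K E) (Matrix.toLin' B - algebraMap K _ a) k
    rw [map_sub, AlgEquiv.commutes] at h1
    exact h1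
  rw [← hE2, LinearEquiv.conj_apply, LinearMap.comp_assoc, LinearEquiv.ker_comp, LinearMap.ker_comp,
    ← Submodule.map_equiv_eq_comap_symm]
  exact (LinearEquiv.finrank_map_eq E _)

theorem finrank_ker_sub_pow_blockDiagonal' {K o : Type*} [Field K] [Fintype o] [DecidableEq o]
    {m : o → Type*} [∀ i, Fintype (m i)] [∀ i, DecidableEq (m i)]
    (M : ∀ i, Matrix (m i) (m i) K) (a : K) (k : ℕ) :
    Module.finrank K
        (LinearMap.ker ((Matrix.toLin' (Matrix.blockDiagonal' M) - algebraMap K _ a) ^ k)) =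
      ∑ i, Module.finrank K (LinearMap.ker ((Matrix.toLin' (M i) - algebraMap K _ a) ^ k)) := by
  have hs : Matrix.blockDiagonal' M - Matrix.scalar _ a =
      Matrix.blockDiagonal' (fun i => M i - Matrix.scalar (m i) a) := by
    rw [show (fun i => M i - Matrix.scalar (m i) a) = M - fun i => Matrix.scalar (m i) a from rfl,
      Matrix.blockDiagonal'_sub]
    congr 1
    simp only [Matrix.scalar_apply]
    exact (Matrix.blockDiagonal'_diagonal fun i (_ : m i) => a).symm
  rw [toLin'_sub_algebraMap_pow, hs, ← Matrix.blockDiagonal'_pow, finrank_ker_blockDiagonal']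
  exact Finset.sum_congr rfl fun i _ => by rw [toLin'_sub_algebraMap_pow]; rfl

/-! ### Recovering sorted sizes from truncated sums -/

/-- For each entry `x`, the second difference of `k ↦ min k x` at `a + 1` is `-1` if `x = a + 1` and
`0` otherwise. -/
theorem count_add_sum_min (M : Multiset ℕ) (a : ℕ) :
    (M.map (min (a + 2))).sum + (M.map (min a)).sum + M.count (a + 1) =
      2 * (M.map (min (a + 1))).sum := by
  induction M using Multiset.induction_on with
  | empty => simp
  | cons x M ih =>
    simp only [Multiset.map_cons, Multiset.sum_cons, Multiset.count_cons]
    split_ifs <;> omega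

theorem filter_pos_eq_of_sum_min {M N : Multiset ℕ}
    (h : ∀ k, (M.map (min k)).sum = (N.map (min k)).sum) :
    M.filter (0 < ·) = N.filter (0 < ·) := by
  ext a
  rcases a with _ | a
  · simp
  · have h1 := count_add_sum_min M a
    have h2 := count_add_sum_min N a
    rw [h, h, h] at h1
    rw [Multiset.count_filter_of_pos (by omega), Multiset.count_filter_of_pos (by omega)]
    omega

/-- In a nonincreasing list the zeros form the tail, where the default value `0` replaces them. -/
theorem getD_filter_pos_of_pairwise (l : List ℕ) (hl : l.Pairwise (· ≥ ·)) (j : ℕ) :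
    (l.filter (0 < ·)).getD j 0 = l.getD j 0 := by
  induction l generalizing j with
  | nil => rfl
  | cons x l ih =>
    rw [List.pairwise_cons] at hl
    rcases Nat.eq_zero_or_pos x with hx | hx
    · have hz : ∀ y ∈ x :: l, y = 0 := by
        intro y hy
        rcases List.mem_cons.1 hy with rfl | hy
        · exact hx
        · have := hl.1 y hy; omega
      have hf : (x :: l).filter (0 < ·) = [] := by
        rw [List.filter_eq_nil_iff]
        intro y hy
        simp [hz y hy]
      rw [hf]
      rcases lt_or_ge j (x :: l).length with hj | hj
      · rw [List.getD_eq_getElem _ _ hj, hz _ (List.getElem_mem hj)]; rfl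
      · rw [List.getD_eq_default _ _ hj]; rfl
    · rw [List.filter_cons_of_pos (by simpa using hx)]
      rcases j with _ | j
      · rfl
      · simpa using ih hl.2 j

/-- The Jordan block sizes at `a`, in nonincreasing order, are read off from a monotone family
with the same truncated sums. -/
theorem jordanSize_eq_of_sum_min {K : Type*} {s t : ℕ} (ev : Fin t → K) (d : Fin t → ℕ) (a : K)
    (hd : ∀ i, 0 < d i) (e : Fin s → ℕ) (he : Monotone e)
    (h : ∀ k, ∑ i, min k (e i) =
      ∑ i, min k (open Classical in if ev i = a then d i else 0)) (j : ℕ) :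
    jordanSize ev d a j = if hj : j < s then e (Fin.rev ⟨j, hj⟩) else 0 := by
  classical
  set D : Multiset ℕ := (Finset.univ.filter fun i => ev i = a).val.map d with hD
  have hDpos : D.filter (0 < ·) = D := by
    rw [Multiset.filter_eq_self]
    intro x hx
    obtain ⟨i, _, rfl⟩ := Multiset.mem_map.1 hx
    exact hd i
  -- `e` increases, so it is reversed to match the decreasing order of block sizes.
  let l : List ℕ := List.ofFn fun i : Fin s => e i.rev
  have hl : l.Pairwise (· ≥ ·) := by
    rw [List.pairwise_ofFn]
    intro i j hij
    exact he (Fin.rev_le_rev.2 hij.le)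
  have hlsum : ∀ k, ((l : Multiset ℕ).map (min k)).sum = (D.map (min k)).sum := by
    intro k
    have h1 : ((l : Multiset ℕ).map (min k)).sum = ∑ i, min k (e i) := by
      rw [Multiset.map_coe, Multiset.sum_coe, List.map_ofFn, List.sum_ofFn]
      exact Equiv.sum_comp Fin.revPerm fun i => min k (e i)
    rw [h1, h, hD, Multiset.map_map]
    change _ = ∑ i ∈ Finset.univ.filter (fun i => ev i = a), min k (d i)
    rw [Finset.sum_filter]
    refine Finset.sum_congr rfl fun i _ => ?_
    split_ifs <;> simp
  -- Some `e i` may vanish, whereas `D` has only positive entries; the two lists agree only after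
  -- zeros are dropped.
  have hfil := filter_pos_eq_of_sum_min hlsum
  rw [hDpos, Multiset.filter_coe] at hfil
  have hsort : D.sort (· ≥ ·) = l.filter (0 < ·) := by
    refine List.Perm.eq_of_pairwise' (r := (· ≥ ·)) (Multiset.pairwise_sort _ _) (hl.filter _) ?_
    rw [← Multiset.coe_eq_coe, Multiset.sort_eq, ← hfil]
  have : jordanSize ev d a j = (D.sort (· ≥ ·)).getD j 0 := by
    rw [hD, jordanSize]
  rw [this, hsort, getD_filter_pos_of_pairwise l hl]
  split_ifs with hj
  · rw [List.getD_eq_getElem _ _ (by simpa [l] using hj)]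
    simp [l]
  · exact List.getD_eq_default _ _ (by simpa [l] using hj)

/-- Size number `j` is `e` at index `s - 1 - j`, so the first `m` sizes occupy the last `m` indices.
For `m > s` the surplus terms are zero and every index is included. -/
theorem sum_range_jordanSize {K : Type*} {s t : ℕ} (ev : Fin t → K) (d : Fin t → ℕ) (a : K)
    (hd : ∀ i, 0 < d i) (e : Fin s → ℕ) (he : Monotone e)
    (h : ∀ k, ∑ i, min k (e i) =
      ∑ i, min k (open Classical in if ev i = a then d i else 0)) (m : ℕ) :
    ∑ j ∈ Finset.range m, jordanSize ev d a j =
      ∑ i ∈ Finset.univ.filter (fun i : Fin s => ¬ (i : ℕ) + m < s), e i := by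
  simp only [jordanSize_eq_of_sum_min ev d a hd e he h]
  rw [Finset.sum_dite, Finset.sum_const_zero, add_zero]
  refine Finset.sum_bij (fun x _ => Fin.rev ⟨x.1, (Finset.mem_filter.1 x.2).2⟩) ?_ ?_ ?_ ?_
  · rintro ⟨x, hx⟩ _
    simp only [Finset.mem_filter, Finset.mem_range] at hx
    simp [Fin.val_rev]; omega
  · rintro ⟨x, hx⟩ _ ⟨y, hy⟩ _ hxy
    simpa using hxy
  · intro i hi
    simp only [Finset.mem_filter, Finset.mem_univ, true_and] at hi
    have := i.2
    refine ⟨⟨i.rev, ?_⟩, Finset.mem_attach _ _, ?_⟩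
    · simp [Fin.val_rev]; omega
    · exact Fin.rev_rev i
  · intros; rfl

/-! ### Kernel dimensions and characteristic polynomial of `A` -/

theorem finrank_ker_of_isJordanForm {K : Type*} [Field K] {n t : ℕ}
    {A : Matrix (Fin n) (Fin n) K} {ev : Fin t → K} {d : Fin t → ℕ} (hJ : IsJordanForm A ev d)
    (a : K) (k : ℕ) :
    Module.finrank K (LinearMap.ker ((Matrix.toLin' A - algebraMap K _ a) ^ k)) =
      ∑ i, min k (open Classical in if ev i = a then d i else 0) := by
  classical
  rw [finrank_ker_eq_of_matSimilar hJ.2, finrank_ker_sub_pow_blockDiagonal']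
  refine Finset.sum_congr rfl fun i _ => ?_
  rw [finrank_ker_jordanBlock]
  split_ifs with h
  · rw [h, rootMultiplicity_X_sub_C_pow]
  · rw [rootMultiplicity_eq_zero]
    rw [IsRoot, eval_pow, eval_sub, eval_X, eval_C]
    exact pow_ne_zero _ (sub_ne_zero.2 (Ne.symm h))

theorem MatSimilar.map {R S ι κ : Type*} [CommRing R] [CommRing S] [Fintype ι] [DecidableEq ι]
    [Fintype κ] [DecidableEq κ] {A : Matrix ι ι R} {B : Matrix κ κ R} (h : MatSimilar A B)
    (f : R →+* S) : MatSimilar (A.map f) (B.map f) := by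
  obtain ⟨P, Q, hPQ, hQP, rfl⟩ := h
  refine ⟨P.map f, Q.map f, ?_, ?_, ?_⟩
  · rw [← Matrix.map_mul, hPQ, Matrix.map_one _ f.map_zero f.map_one]
  · rw [← Matrix.map_mul, hQP, Matrix.map_one _ f.map_zero f.map_one]
  · rw [Matrix.map_mul, Matrix.map_mul]

theorem finrank_ker_of_isRationalCanonicalForm {F K : Type*} [Field F] [Field K] [Algebra F K]
    {n s : ℕ} {A : Matrix (Fin n) (Fin n) F} {p : Fin s → F[X]} (hp : IsRationalCanonicalForm A p)
    (a : K) (k : ℕ) :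
    Module.finrank K (LinearMap.ker
        ((Matrix.toLin' (A.map (algebraMap F K)) - algebraMap K _ a) ^ k)) =
      ∑ i, min k (rootMultiplicity a ((p i).map (algebraMap F K))) := by
  rw [finrank_ker_eq_of_matSimilar (hp.2.2.map (algebraMap F K)),
    Matrix.blockDiagonal'_map _ _ (map_zero _), finrank_ker_sub_pow_blockDiagonal']
  refine Finset.sum_congr rfl fun i _ => ?_
  refine finrank_ker_companion _ ((hp.1 i).map _) (natDegree_map _) _ (fun x y => ?_) a k
  simp only [companionMat, Matrix.map_apply, Matrix.of_apply, coeff_map]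
  split_ifs <;> simp

theorem rootMultiplicity_charpoly_eq_finrank_ker {K : Type*} [Field K] {n : ℕ}
    (A : Matrix (Fin n) (Fin n) K) (a : K) :
    rootMultiplicity a A.charpoly =
      Module.finrank K (LinearMap.ker ((Matrix.toLin' A - algebraMap K _ a) ^ n)) := by
  have h := LinearMap.finrank_maxGenEigenspace_eq (Matrix.toLin' A) a
  rw [Matrix.charpoly_toLin', Module.End.maxGenEigenspace_eq_genEigenspace_finrank,
    Module.End.genEigenspace_nat, Module.finrank_fin_fun] at h
  rw [← h, Algebra.algebraMap_eq_smul_one]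

/-- This is the kernel formula at `k = n`. The degrees of the `p i` sum to `n`, so no multiplicity
exceeds `n` and the truncation disappears. -/
theorem rootMultiplicity_charpoly_of_isRationalCanonicalForm {F K : Type*} [Field F] [Field K]
    [Algebra F K] {n s : ℕ} {A : Matrix (Fin n) (Fin n) F} {p : Fin s → F[X]}
    (hp : IsRationalCanonicalForm A p) (a : K) :
    rootMultiplicity a (A.charpoly.map (algebraMap F K)) =
      ∑ i, rootMultiplicity a ((p i).map (algebraMap F K)) := by
  have hn : ∑ i, (p i).natDegree = n := by
    obtain ⟨P, Q, hPQ, hQP, -⟩ := hp.2.2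
    have := (Matrix.toLin'OfInv hQP hPQ).finrank_eq
    simpa using this
  rw [← Matrix.charpoly_map, rootMultiplicity_charpoly_eq_finrank_ker,
    finrank_ker_of_isRationalCanonicalForm hp]
  refine Finset.sum_congr rfl fun i _ => min_eq_right ?_
  calc rootMultiplicity a ((p i).map (algebraMap F K))
      ≤ ((p i).map (algebraMap F K)).natDegree := by
        classical
        rw [← count_roots]
        exact (Multiset.count_le_card _ _).trans (card_roots' _)
    _ = (p i).natDegree := natDegree_map _
    _ ≤ n := hn ▸ Finset.single_le_sum (f := fun i => (p i).natDegree)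
        (fun _ _ => Nat.zero_le _) (Finset.mem_univ i)

/-! ### Multiplicities, divisibility and the main equivalence -/

theorem zeroMult_eq_rootMultiplicity {F K : Type*} [Field F] [Field K] [Algebra F K] (a : K)
    {q : F[X]} (hq : q ≠ 0) :
    zeroMult a q = (rootMultiplicity a (q.map (algebraMap F K)) : ℕ∞) := by
  classical
  have hq' : q.map (algebraMap F K) ≠ 0 := map_ne_zero hq
  rw [zeroMult, rootMultiplicity_eq_multiplicity, if_neg hq',
    (finiteMultiplicity_X_sub_C a hq').emultiplicity_eq_multiplicity]

theorem hasEigenvalue_toLin'_of_rootMultiplicity_charpoly_ne_zero {K : Type*} [Field K] {n : ℕ}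
    (A : Matrix (Fin n) (Fin n) K) (a : K) (h : rootMultiplicity a A.charpoly ≠ 0) :
    Module.End.HasEigenvalue (Matrix.toLin' A) a := by
  rw [Module.End.hasEigenvalue_iff_isRoot_charpoly, Matrix.charpoly_toLin']
  by_contra hr
  exact h (rootMultiplicity_eq_zero hr)

/-- Divisibility can be tested after extending the field, and over `K` both polynomials split. -/
theorem dvd_iff_forall_rootMultiplicity_le {F K : Type*} [Field F] [Field K] [Algebra F K]
    [IsAlgClosed K] {f g : F[X]} (hf : f ≠ 0) (hg : g ≠ 0) :
    f ∣ g ↔ ∀ a : K, rootMultiplicity a (f.map (algebraMap F K)) ≤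
      rootMultiplicity a (g.map (algebraMap F K)) := by
  classical
  rw [← map_dvd_map' (algebraMap F K),
    IsAlgClosed.dvd_iff_roots_le_roots (map_ne_zero hf) (map_ne_zero hg), Multiset.le_iff_count]
  simp only [count_roots]

/-- The block sizes stand on the side of `zeroMult`, which avoids truncated subtraction in `ℕ∞`;
likewise `i + m < s` selects the first `s - m` factors, and none if `m ≥ s`. -/
theorem mainTheorem2 {F : Type*} [Field F] {K : Type*} [Field K] [Algebra F K] [IsAlgClosure F K]
    {n s t : ℕ} (A : Matrix (Fin n) (Fin n) F)
    (p : Fin s → F[X]) (hp : IsRationalCanonicalForm A p)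
    (ev : Fin t → K) (d : Fin t → ℕ) (hJ : IsJordanForm (A.map (algebraMap F K)) ev d)
    (m : ℕ) (q : F[X]) :
    (∀ lam : K, Module.End.HasEigenvalue (Matrix.toLin' (A.map (algebraMap F K))) lam →
        algMult lam A ≤ zeroMult lam q + ∑ j ∈ Finset.range m, (jordanSize ev d lam j : ℕ∞)) ↔
      (∏ i ∈ Finset.univ.filter (fun i : Fin s => (i : ℕ) + m < s), p i) ∣ q := by
  have : IsAlgClosed K := IsAlgClosure.isAlgClosed F
  rcases eq_or_ne q 0 with rfl | hq
  -- For `q = 0` the multiplicity is `∞` and everything divides `q`, so both sides hold.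
  · simp [zeroMult]
  have hp0 : ∀ i, p i ≠ 0 := fun i => (hp.1 i).ne_zero
  set f := ∏ i ∈ Finset.univ.filter (fun i : Fin s => (i : ℕ) + m < s), p i with hf
  have hf0 : f ≠ 0 := Finset.prod_ne_zero_iff.2 fun i _ => hp0 i
  rw [dvd_iff_forall_rootMultiplicity_le (K := K) hf0 hq]
  refine forall_congr' fun a => ?_
  set e : Fin s → ℕ := fun i => rootMultiplicity a ((p i).map (algebraMap F K)) with he
  have hmono : Monotone e := fun i j hij =>
    rootMultiplicity_le_rootMultiplicity_of_dvd (map_ne_zero (hp0 j))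
      (map_dvd (mapRingHom (algebraMap F K)) (hp.2.1 i j hij)) a
  have hsum := sum_range_jordanSize ev d a hJ.1 e hmono (fun k => by
    rw [← finrank_ker_of_isJordanForm hJ, finrank_ker_of_isRationalCanonicalForm hp]) m
  have halg := rootMultiplicity_charpoly_of_isRationalCanonicalForm hp a
  have hfe : rootMultiplicity a (f.map (algebraMap F K)) =
      ∑ i ∈ Finset.univ.filter (fun i : Fin s => (i : ℕ) + m < s), e i := by
    have h1 : (rootMultiplicity a (f.map (algebraMap F K)) : ℕ∞) =
        ((∑ i ∈ Finset.univ.filter (fun i : Fin s => (i : ℕ) + m < s), e i : ℕ) : ℕ∞) := by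
      rw [← zeroMult_eq_rootMultiplicity a hf0, zeroMult, hf, Polynomial.map_prod,
        Finset.emultiplicity_prod (prime_X_sub_C a), Nat.cast_sum]
      exact Finset.sum_congr rfl fun i _ => zeroMult_eq_rootMultiplicity a (hp0 i)
    exact_mod_cast h1
  have hsplit := Finset.sum_filter_add_sum_filter_not Finset.univ
    (fun i : Fin s => (i : ℕ) + m < s) e
  rw [algMult, zeroMult_eq_rootMultiplicity a A.charpoly_monic.ne_zero,
    zeroMult_eq_rootMultiplicity a hq, ← Nat.cast_sum, ← Nat.cast_add, Nat.cast_le, hsum, halg, hfe]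
  change (_ → ∑ i, e i ≤ _) ↔ _
  -- The last `m` exponents occur on both sides and cancel, leaving the multiplicity of `a` in `f`.
  rw [← hsplit, Nat.add_le_add_iff_right]
  refine ⟨fun h => ?_, fun h _ => h⟩
  -- The condition speaks only of eigenvalues. If the sum is zero, `a` is not a root of `f` and the
  -- bound is trivial; otherwise `a` is a root of the characteristic polynomial.
  by_cases h0 : ∑ i, e i = 0
  · have : ∑ i ∈ Finset.univ.filter (fun i : Fin s => (i : ℕ) + m < s), e i = 0 := by omega
    rw [this]
    exact Nat.zero_le _
  · refine h (hasEigenvalue_toLin'_of_rootMultiplicity_charpoly_ne_zero _ _ ?_)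
    rwa [Matrix.charpoly_map, halg]
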